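/- Let $q$ be an odd prime power, and let $\mathrm{Tr}$ and $\mathrm{N}$ denote the trace and norm of $\mathbb{F}_{q^5}/\mathbb{F}_q$. An $\mathbb{F}_q$-subspace $U$ of $\mathbb{F}_{q^5}^2$ is called scattered if $\dim_{\mathbb{F}_q}(U\cap H)\le 1$ for every one-dimensional $\mathbb{F}_{q^5}$-subspace $H$ of $\mathbb{F}_{q^5}^2$. For $\delta\in\mathbb{F}_{q^5}$ with $\mathrm{N}(\delta)=1$ put $$U_\delta=\{(x,\,x^q+\delta x^{q^4}) : x\in\mathbb{F}_{q^5},\ \mathrm{Tr}(x)=0\}\le\mathbb{F}_{q^5}^2$$ and $$f_\delta(Y)=Y^2+\left(\delta^{q^3+q^2+q+1}-\delta^{q^2+q+1}+\delta^{q+1}-\delta-1\right)Y-\delta^{q^3+q^2+q+2}-\delta^{q+1}+\delta\in\mathbb{F}_{q^5}[Y].$$ (a) For every $\delta\in\mathbb{F}_{q^5}$ with $\mathrm{N}(\delta)=1$, the subspace $U_\delta$ is scattered of $\mathbb{F}_q$-dimension $4$ if and only if $f_\delta(Y)$ has no root in $\mathbb{F}_{q^5}$. (b) If $q=3^{2h+1}$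 for some integer $h\ge 0$, then $U_1=\{(x,\,x^q+x^{q^4}) : x\in\mathbb{F}_{q^5},\ \mathrm{Tr}(x)=0\}$ is scattered of $\mathbb{F}_q$-dimension $4$. -/

import Mathlib

open Polynomial

/-- An `F`-subspace `U` of `K ^ k` is `(h, r)`-evasive if it meets every `h`-dimensional
`K`-subspace of `K ^ k` in an `F`-space of dimension at most `r`. -/
def IsEvasive {F K : Type*} [Field F] [Field K] [Algebra F K] {k : ℕ} (h r : ℕ)
    (U : Submodule F (Fin k → K)) : Prop :=
  ∀ H : Submodule K (Fin k → K), Module.finrank K H = h →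
    Module.finrank F (U ⊓ H.restrictScalars F : Submodule F (Fin k → K)) ≤ r

/-- `U` is scattered if it is `(1, 1)`-evasive. -/
def IsScattered {F K : Type*} [Field F] [Field K] [Algebra F K] {k : ℕ}
    (U : Submodule F (Fin k → K)) : Prop :=
  IsEvasive 1 1 U

/-- With `q = |F|`, the `F`-subspace `U_δ = {(x, x^q + δ x^(q^4)) : Tr_{K/F}(x) = 0}` of `K ^ 2`. -/
def subspaceU (F : Type*) {K : Type*} [Field F] [Fintype F] [Field K] [Algebra F K] (δ : K) :
    Submodule F (Fin 2 → K) where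
  carrier := {v | ∃ x : K, Algebra.trace F K x = 0 ∧
    v = ![x, x ^ Fintype.card F + δ * x ^ Fintype.card F ^ 4]}
  zero_mem' := by
    refine ⟨0, map_zero _, ?_⟩
    have hc : Fintype.card F ≠ 0 := Fintype.card_ne_zero
    ext i
    fin_cases i <;> simp [hc]
  add_mem' := by
    rintro _ _ ⟨x, hx, rfl⟩ ⟨y, hy, rfl⟩
    refine ⟨x + y, by rw [map_add, hx, hy, add_zero], ?_⟩
    have h1 : ∀ a b : K, (a + b) ^ Fintype.card F = a ^ Fintype.card F + b ^ Fintype.card F :=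
      fun a b => map_add (FiniteField.frobeniusAlgHom F K) a b
    have h4 : (x + y) ^ Fintype.card F ^ 4 = x ^ Fintype.card F ^ 4 + y ^ Fintype.card F ^ 4 := by
      simp only [pow_succ, pow_zero, one_mul, pow_mul, h1]
    ext i
    fin_cases i
    · simp
    · simp only [h1, h4, Fin.mk_one, Pi.add_apply, Matrix.cons_val_one, Matrix.cons_val_fin_one]
      ring
  smul_mem' := by
    rintro c _ ⟨x, hx, rfl⟩
    refine ⟨c • x, by rw [map_smul, hx, smul_zero], ?_⟩
    have h1 : ∀ a : K, (c • a) ^ Fintype.card F = c • a ^ Fintype.card F :=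
      fun a => map_smul (FiniteField.frobeniusAlgHom F K) c a
    have h4 : (c • x) ^ Fintype.card F ^ 4 = c • x ^ Fintype.card F ^ 4 := by
      simp only [pow_succ, pow_zero, one_mul, pow_mul, h1]
    ext i
    fin_cases i
    · simp
    · simp only [h1, h4, Fin.mk_one, Pi.smul_apply, Matrix.cons_val_one, Matrix.cons_val_fin_one,
        smul_add, mul_smul_comm]

/-- The quadratic polynomial `f_δ(Y)`, with coefficients depending on `q` and `δ`. -/
noncomputable def polyF {K : Type*} [Field K] (q : ℕ) (δ : K) : K[X] :=
  X ^ 2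
    + C (δ ^ (q ^ 3 + q ^ 2 + q + 1) - δ ^ (q ^ 2 + q + 1) + δ ^ (q + 1) - δ - 1) * X
    + C (-δ ^ (q ^ 3 + q ^ 2 + q + 2) - δ ^ (q + 1) + δ)

/-!
Write `σ` for the Frobenius `z ↦ z ^ q` of `K / F`, where `q = |F|`, so that `σ ^ 5 = 1`. The
subspace `U_δ` always has dimension `4`, the dimension of the kernel of the trace. It fails to be
scattered iff there are `F`-independent `x, y` of trace zero such that `(x, σ x + δ σ⁴ x)` and
`(y, σ y + δ σ⁴ y)` are proportional over `K`.

Such a pair is described by the Plücker coordinates of the plane spanned by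
`(x, σ x, …, σ⁴ x)` and `(y, σ y, …, σ⁴ y)`. Up to sign these are the conjugates of
`a = x σ y - y σ x` and `b = x σ² y - y σ² x`, and
* independence over `F` means `a ≠ 0`;
* proportionality over `K` means `a = δ σ⁴ a`, which by Hilbert 90 determines `a` up to `Fˣ`
  when `N(δ) = 1`;
* the trace conditions mean `b - σ³ b = σ⁴ a - a`, i.e. `b = c - a - σ a - σ³ a` with `σ c = c`;
* the Plücker relation is `a σ² a = b σ b + σ³ b σ a`, which becomes
  `c ^ 2 - Tr(a) c + Tr(a σ a) = 0`.

The substitution `c = σ⁴ a Y + σ a + σ³ a` turns the last quadratic into `(σ⁴ a) ^ 2 f_δ(Y)`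
(`polyF_isRoot_iff`). Hence a pair `x, y` gives a root of `f_δ` in `K` (`plucker_quadratic`).

Conversely, let `Y ∈ K` be a root and define `a`, `c`, `b` by these formulas. The quadratic has
coefficients in `F` and the degree `5` is odd, so `σ c = c` (`map_eq_self_of_quadratic`). The plane
with Plücker coordinates `a, b` has to be realized by elements of `K`: its elements are the roots of
`a X ^ (q ^ 2) - b X ^ q + σ(a) X`, and the Plücker relation forces this polynomial to divide
`X ^ (q ^ 5) - X`, so it has `q ^ 2` roots in `K` (`card_roots_of_plucker`). These give `q ^ 2`
vectors of `U_δ` on one `K`-line, too many for a scattered subspace.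

For `δ = 1` the polynomial is `Y ^ 2 - Y - 1`, of discriminant `5`. In characteristic `3` this is
`-1`, a nonsquare in a field with `3 ^ (odd)` elements.
-/

/-! ### Identities for a ring endomorphism of order five -/

/-- If `a` is a unit and `a, b` satisfy the Plücker relation, then the recurrence
`a σ² t = b σ t - σ(a) t` expresses `σ³ t` and `σ⁴ t` through `t` and `σ t` with conjugates of
`a, b` as coefficients, and closes up with period five. -/
theorem isUnit_recurrence {R : Type*} [CommRing R] (σ : R →+* R) {a b t : R}
    (hu : IsUnit a) (ha : σ (σ (σ (σ (σ a)))) = a) (hb : σ (σ (σ (σ (σ b)))) = b)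
    (hab : a * σ (σ a) = b * σ b + σ (σ (σ b)) * σ a)
    (ht : a * σ (σ t) = b * σ t - σ a * t) :
    a * σ (σ (σ t)) = -σ b * t - σ (σ (σ b)) * σ t ∧
      a * σ (σ (σ (σ t))) = σ (σ (σ (σ b))) * t - σ (σ (σ (σ a))) * σ t ∧
      σ (σ (σ (σ (σ t)))) = t := by
  have hu1 : IsUnit (σ a) := hu.map σ
  have h1 := congrArg σ ht
  -- The conjugate of the Plücker relation under `σ⁴` is the one needed to simplify `σ⁴ t`.
  have hab4 := congrArg (fun z => σ (σ (σ (σ z)))) hab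
  simp only [map_mul, map_sub, map_add, ha, hb] at h1 hab4
  have h2 : a * σ (σ (σ t)) = -σ b * t - σ (σ (σ b)) * σ t := by
    refine hu1.mul_left_cancel ?_
    linear_combination a * h1 + σ b * ht - σ t * hab
  have h3 := congrArg σ h2
  simp only [map_mul, map_sub, map_neg] at h3
  have h4 : a * σ (σ (σ (σ t))) = σ (σ (σ (σ b))) * t - σ (σ (σ (σ a))) * σ t := by
    refine hu1.mul_left_cancel ?_
    linear_combination a * h3 - σ (σ (σ (σ b))) * ht + σ t * hab4
  have h5 := congrArg σ h4
  simp only [map_mul, map_sub, ha, hb] at h5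
  refine ⟨h2, h4, hu1.mul_left_cancel ?_⟩
  linear_combination h5 - ht

/-- The Plücker coordinates `a, b` of two elements `x, y` of trace zero satisfy a quadratic equation
in `b + a`: the trace conditions express `σ b` and `σ³ b` through `b` and conjugates of `a`, and the
Plücker relation then involves `b` alone. -/
theorem plucker_quadratic {R : Type*} [CommRing R] (σ : R →+* R) (hσ : ∀ z, σ (σ (σ (σ (σ z)))) = z)
    {x y a b : R}
    (hx : x + σ x + σ (σ x) + σ (σ (σ x)) + σ (σ (σ (σ x))) = 0)
    (hy : y + σ y + σ (σ y) + σ (σ (σ y)) + σ (σ (σ (σ y))) = 0)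
    (ha : a = x * σ y - y * σ x) (hb : b = x * σ (σ y) - y * σ (σ x)) :
    (b + a) ^ 2 + (σ (σ (σ a)) - σ (σ a) + σ a - a - σ (σ (σ (σ a)))) * (b + a)
      + (a * σ (σ (σ (σ a))) - a * σ (σ (σ a)) - σ a * σ (σ (σ (σ a)))) = 0 := by
  have h3 : σ (σ (σ b)) = b + a - σ (σ (σ (σ a))) := by
    simp only [ha, hb, map_mul, map_sub, hσ]
    linear_combination -x * hy + y * hx
  have h1 : σ b = σ (σ (σ b)) - σ (σ a) + σ (σ (σ a)) := by
    simp only [ha, hb, map_mul, map_sub, hσ]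
    linear_combination -σ (σ (σ x)) * hy + σ (σ (σ y)) * hx
  have hP : a * σ (σ a) = b * σ b + σ (σ (σ b)) * σ a := by
    simp only [ha, hb, map_mul, map_sub, hσ]
    ring
  rw [h3, h1, h3] at hP
  linear_combination -hP

/-- A root of a quadratic with `σ`-invariant coefficients is itself `σ`-invariant when `σ ^ 5 = 1`:
its `σ`-orbit has at most two elements, and five is odd. -/
theorem map_eq_self_of_quadratic {R : Type*} [CommRing R] [IsDomain R] (σ : R →+* R)
    (hσ : ∀ z, σ (σ (σ (σ (σ z)))) = z) {c s p : R} (hs : σ s = s) (hp : σ p = p)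
    (hc : c ^ 2 - s * c + p = 0) : σ c = c := by
  have h := congrArg σ hc
  simp only [map_add, map_sub, map_mul, map_pow, map_zero, hs, hp] at h
  have h0 : (σ c - c) * (σ c - (s - c)) = 0 := by linear_combination h - hc
  rcases mul_eq_zero.1 h0 with h1 | h1
  · exact sub_eq_zero.1 h1
  · have h2 : σ (σ c) = c := by
      rw [sub_eq_zero.1 h1, map_sub, hs, sub_eq_zero.1 h1]
      ring
    have h5 := hσ c
    rwa [h2, h2] at h5

/-! ### Frobenius, norm and trace of the quintic extension -/

theorem frobenius_five {F K : Type*} [Field F] [Fintype F] [Field K] [Algebra F K]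
    (hK : Module.finrank F K = 5) (z : K) :
    let q := Fintype.card F
    ((((z ^ q) ^ q) ^ q) ^ q) ^ q = z := by
  have : Module.Finite F K := Module.finite_of_finrank_pos (by omega)
  have : Finite K := Module.finite_of_finite F
  have := Fintype.ofFinite K
  simp only [← pow_mul, ← sq]
  simp only [← pow_succ]
  norm_num
  rw [← hK, ← Module.card_eq_pow_finrank, FiniteField.pow_card]

/-- Hilbert's theorem 90 for a finite field, with Frobenius as generator of the Galois group. It is
read off from the cyclic group `Kˣ`: an element killed by `1 + q + ⋯ + q ^ (n - 1)` is a
`(q - 1)`-st power. -/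
theorem exists_pow_card_eq_mul {F K : Type*} [Field F] [Fintype F] [Field K] [Algebra F K]
    [FiniteDimensional F K] {δ : K} (hδ : Algebra.norm F δ = 1) :
    ∃ α : K, α ≠ 0 ∧ α ^ Fintype.card F = δ * α := by
  have : Finite K := Module.finite_of_finite F
  have := Fintype.ofFinite K
  have hq : 1 < Fintype.card F := Fintype.one_lt_card
  have hδ0 : δ ≠ 0 := by
    rintro rfl
    simp [Algebra.norm_zero] at hδ
  have hpow := FiniteField.algebraMap_norm_eq_pow_sum F K δ
  rw [hδ, map_one, Nat.card_eq_fintype_card] at hpow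
  obtain ⟨g, hg⟩ := IsCyclic.exists_generator (α := Kˣ)
  obtain ⟨n, hn⟩ : Units.mk0 δ hδ0 ∈ Submonoid.powers g := by
    rw [mem_powers_iff_mem_zpowers]
    exact hg _
  simp only at hn
  set S := ∑ i ∈ Finset.range (Module.finrank F K), Fintype.card F ^ i with hS
  have hmul : (Fintype.card F - 1) * S = orderOf g := by
    rw [orderOf_eq_card_of_forall_mem_zpowers hg, Nat.card_units, Nat.card_eq_fintype_card,
      Module.card_eq_pow_finrank (K := F) (V := K), hS, mul_comm, Nat.geomSum_eq hq,
      Nat.div_mul_cancel (Nat.sub_one_dvd_pow_sub_one _ _)]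
  have hS0 : 0 < S := by
    refine Nat.pos_of_ne_zero fun h0 => ?_
    rw [h0, mul_zero] at hmul
    exact (orderOf_pos g).ne hmul
  obtain ⟨m, hm⟩ : Fintype.card F - 1 ∣ n := by
    refine Nat.dvd_of_mul_dvd_mul_right hS0 ?_
    rw [hmul]
    refine orderOf_dvd_of_pow_eq_one ?_
    rw [pow_mul, hn]
    ext
    simpa using hpow.symm
  refine ⟨((g ^ m : Kˣ) : K), Units.ne_zero _, ?_⟩
  have hδg : δ = ((g ^ n : Kˣ) : K) := by rw [hn, Units.val_mk0]
  rw [hδg, hm]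
  norm_cast
  rw [← pow_mul, ← pow_add, ← Nat.succ_mul, Nat.succ_eq_add_one, Nat.sub_add_cancel hq.le,
    mul_comm]

theorem trace_eq_zero_iff {F K : Type*} [Field F] [Fintype F] [Field K] [Algebra F K]
    (hK : Module.finrank F K = 5) (x : K) :
    Algebra.trace F K x = 0 ↔
      let q := Fintype.card F
      x + x ^ q + (x ^ q) ^ q + ((x ^ q) ^ q) ^ q + (((x ^ q) ^ q) ^ q) ^ q = 0 := by
  have : Module.Finite F K := Module.finite_of_finrank_pos (by omega)
  have : Finite K := Module.finite_of_finite F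
  have h := FiniteField.algebraMap_trace_eq_sum_pow F K x
  rw [hK, Nat.card_eq_fintype_card] at h
  rw [← FaithfulSMul.algebraMap_eq_zero_iff F K, h]
  simp only [Finset.sum_range_succ, Finset.sum_range_zero, ← pow_mul]
  simp [pow_succ]

theorem exists_algebraMap_eq_of_pow_card {F K : Type*} [Field F] [Fintype F] [Field K]
    [Algebra F K] {x : K} (hx : x ^ Fintype.card F = x) : ∃ c : F, algebraMap F K c = x := by
  classical
  have hq : 1 < Fintype.card F := Fintype.one_lt_card
  have hne : (X ^ Fintype.card F - X : K[X]) ≠ 0 := FiniteField.X_pow_card_sub_X_ne_zero K hq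
  by_contra! hc
  have h := card_le_degree_of_subset_roots (p := (X ^ Fintype.card F - X : K[X]))
    (Z := insert x (Finset.univ.image (algebraMap F K))) fun y hy => by
      rw [mem_roots hne]
      simp only [Finset.mem_val, Finset.mem_insert, Finset.mem_image, Finset.mem_univ,
        true_and] at hy
      rcases hy with rfl | ⟨c, rfl⟩
      · simp [hx]
      · simp [← map_pow, FiniteField.pow_card]
  rw [Finset.card_insert_of_notMem (by simpa using hc),
    Finset.card_image_of_injective _ (algebraMap F K).injective, Finset.card_univ,
    FiniteField.X_pow_card_sub_X_natDegree_eq K hq] at h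
  omega

/-! ### The polynomial `f_δ` and the dimension of `U_δ` -/

/-- With `α = σ⁴ a`, so that `a = δ α`, the powers of `δ` in `f_δ` become ratios of conjugates of
`a`, and `α ^ 2 f_δ(y)` is a quadratic in `α y` whose coefficients are polynomials in these
conjugates. -/
theorem polyF_isRoot_iff {K : Type*} [Field K] {q : ℕ} {δ α : K} (hα : α ≠ 0)
    (h : α ^ q = δ * α) (y : K) :
    (polyF q δ).IsRoot y ↔
      (α * y) ^ 2 + ((((α ^ q) ^ q) ^ q) ^ q - ((α ^ q) ^ q) ^ q + (α ^ q) ^ q - α ^ q - α)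
        * (α * y) + (α ^ q * α - α ^ q * (((α ^ q) ^ q) ^ q) ^ q - (α ^ q) ^ q * α) = 0 := by
  have h1 : (α ^ q) ^ q = δ ^ (q + 1) * α := by
    rw [h, mul_pow, h]; ring
  have h2 : ((α ^ q) ^ q) ^ q = δ ^ (q ^ 2 + q + 1) * α := by
    rw [h1, mul_pow, h]; ring
  have h3 : (((α ^ q) ^ q) ^ q) ^ q = δ ^ (q ^ 3 + q ^ 2 + q + 1) * α := by
    rw [h2, mul_pow, h]; ring
  rw [h3, h2, h1, h]
  simp only [polyF, IsRoot.def, eval_add, eval_mul, eval_C, eval_pow, eval_X]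
  rw [← mul_eq_zero_iff_left (pow_ne_zero 2 hα)]
  refine Eq.congr ?_ rfl
  ring

theorem finrank_subspaceU {F K : Type*} [Field F] [Fintype F] [Field K] [Algebra F K]
    (hK : Module.finrank F K = 5) (δ : K) : Module.finrank F (subspaceU F δ) = 4 := by
  have : Module.Finite F K := Module.finite_of_finrank_pos (by omega)
  have hker := (Algebra.trace F K).finrank_range_add_finrank_ker
  rw [LinearMap.range_eq_top.2 (Algebra.trace_surjective F K), finrank_top, Module.finrank_self,
    hK] at hker
  let e : subspaceU F δ →ₗ[F] LinearMap.ker (Algebra.trace F K) :=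
    ((LinearMap.proj (0 : Fin 2)).comp (subspaceU F δ).subtype).codRestrict _ (by
      rintro ⟨_, x, hx, rfl⟩
      simpa using hx)
  have he : Function.Bijective e := by
    constructor
    · rintro ⟨_, x, hx, rfl⟩ ⟨_, y, hy, rfl⟩ hxy
      have : x = y := by simpa [e] using congrArg Subtype.val hxy
      subst this
      rfl
    · rintro ⟨x, hx⟩
      exact ⟨⟨_, x, hx, rfl⟩, Subtype.ext (by simp [e])⟩
  rw [(LinearEquiv.ofBijective e he).finrank_eq]
  omega

/-! ### Realizing a plane with given Plücker coordinates -/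

open FiniteField in
/-- If `a ≠ 0` and `a, b` satisfy the Plücker relation, the linearized polynomial
`a X ^ (q ^ 2) - b X ^ q + a ^ q X` has `q ^ 2` distinct roots in `K`. -/
theorem card_roots_of_plucker {F K : Type*} [Field F] [Fintype F] [Field K] [Algebra F K]
    (hK : Module.finrank F K = 5) {a b : K} (ha : a ≠ 0)
    (hab : a * (a ^ Fintype.card F) ^ Fintype.card F = b * b ^ Fintype.card F
      + ((b ^ Fintype.card F) ^ Fintype.card F) ^ Fintype.card F * a ^ Fintype.card F) :
    ∃ s : Finset K, s.card = Fintype.card F ^ 2 ∧ ∀ x ∈ s,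
      a * (x ^ Fintype.card F) ^ Fintype.card F
        = b * x ^ Fintype.card F - a ^ Fintype.card F * x := by
  classical
  have : Module.Finite F K := Module.finite_of_finrank_pos (by omega)
  have : Finite K := Module.finite_of_finite F
  have := Fintype.ofFinite K
  set q := Fintype.card F with hqdef
  have hq : 1 < q := Fintype.one_lt_card
  have hcard : Fintype.card K = q ^ 5 := by rw [Module.card_eq_pow_finrank (K := F), hK]
  have hσ : ∀ z : K, ((((z ^ q) ^ q) ^ q) ^ q) ^ q = z := frobenius_five hK
  let P : K[X] := C a * X ^ q ^ 2 - C b * X ^ q + C (a ^ q) * X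
  have hdeg : P.natDegree = q ^ 2 := by
    have h1 : q < q ^ 2 := by nlinarith
    simp only [P]
    compute_degree
    · simpa [h1.ne', hq.ne'] using ha
    all_goals omega
  have hdvd : P ∣ X ^ q ^ 5 - X := by
    -- Modulo `P` the class of `X` satisfies the recurrence for the `q`-power map, so its
    -- `q ^ 5`-th power is itself.
    rw [← AdjoinRoot.mk_eq_zero, map_sub, map_pow, AdjoinRoot.mk_X, sub_eq_zero]
    have ht : AdjoinRoot.mk P P = 0 := AdjoinRoot.mk_self
    have h := isUnit_recurrence (frobeniusAlgHom F (AdjoinRoot P)).toRingHom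
      (a := AdjoinRoot.of P a) (b := AdjoinRoot.of P b) (t := AdjoinRoot.root P)
      ((isUnit_iff_ne_zero.2 ha).map _)
    simp only [AlgHom.toRingHom_eq_coe, RingHom.coe_coe, coe_frobeniusAlgHom, ← map_pow, ← map_mul,
      ← map_add, ← hqdef, hσ, ← hab, forall_const] at h
    refine Eq.trans ?_ (h ?_).2.2
    · simp only [← pow_mul]
      congr 1
      ring
    · simp only [P, map_add, map_sub, map_mul, map_pow, AdjoinRoot.mk_X, AdjoinRoot.mk_C] at ht
      rw [← pow_mul, ← sq, map_pow]
      linear_combination ht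
  have hne : (X ^ q ^ 5 - X : K[X]) ≠ 0 :=
    FiniteField.X_pow_card_sub_X_ne_zero K (Nat.one_lt_pow (by norm_num) hq)
  have hroots : (X ^ q ^ 5 - X : K[X]).roots = Finset.univ.val := by
    rw [← hcard, FiniteField.roots_X_pow_card_sub_X]
  have hsplit : P.Splits := by
    refine Polynomial.Splits.of_dvd (splits_iff_card_roots.2 ?_) hne hdvd
    rw [hroots, FiniteField.X_pow_card_sub_X_natDegree_eq K (Nat.one_lt_pow (by norm_num) hq),
      ← hcard]
    rfl
  have hnodup : P.roots.Nodup := by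
    refine Multiset.nodup_of_le (roots.le_of_dvd hne hdvd) ?_
    rw [hroots]
    exact Finset.univ.nodup
  refine ⟨⟨P.roots, hnodup⟩, ?_, fun x hx => ?_⟩
  · rw [Finset.card_mk, splits_iff_card_roots.1 hsplit, hdeg]
  · have hx' := isRoot_of_mem_roots (Finset.mem_mk.1 hx)
    simp only [P, IsRoot.def, eval_add, eval_sub, eval_mul, eval_C, eval_pow, eval_X] at hx'
    rw [← pow_mul, ← sq]
    linear_combination hx'

/-! ### Scatteredness and roots of `f_δ` -/

theorem isScattered_of_no_root {F K : Type*} [Field F] [Fintype F] [Field K] [Algebra F K]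
    (hK : Module.finrank F K = 5) {δ : K}
    (hroot : ¬ ∃ y : K, (polyF (Fintype.card F) δ).IsRoot y) : IsScattered (subspaceU F δ) := by
  have : Module.Finite F K := Module.finite_of_finrank_pos (by omega)
  set q := Fintype.card F with hqdef
  let σ : K →+* K := (FiniteField.frobeniusAlgHom F K).toRingHom
  have hσq : ∀ z, z ^ q = σ z := fun z => rfl
  have hσ := frobenius_five hK
  rw [← hqdef] at hσ
  simp only [hσq] at hσ
  intro H hH
  obtain ⟨v, -, hv⟩ := finrank_eq_one_iff'.1 hH
  have hdet : ∀ u ∈ H, ∀ w ∈ H, u 0 * w 1 = w 0 * u 1 := by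
    intro u hu w hw
    obtain ⟨c, hc⟩ := hv ⟨u, hu⟩
    obtain ⟨d, hd⟩ := hv ⟨w, hw⟩
    obtain rfl : c • (v : Fin 2 → K) = u := congrArg Subtype.val hc
    obtain rfl : d • (v : Fin 2 → K) = w := congrArg Subtype.val hd
    simp only [Pi.smul_apply, smul_eq_mul]
    ring
  rw [finrank_le_one_iff]
  by_cases hbot : ∀ w : (subspaceU F δ ⊓ H.restrictScalars F : Submodule F (Fin 2 → K)), w = 0
  · exact ⟨0, fun w => ⟨0, by rw [hbot w, smul_zero]⟩⟩
  push Not at hbot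
  obtain ⟨⟨_, ⟨x, hx, rfl⟩, hxH⟩, hx0⟩ := hbot
  refine ⟨⟨_, ⟨x, hx, rfl⟩, hxH⟩, ?_⟩
  rintro ⟨_, ⟨y, hy, rfl⟩, hyH⟩
  have hx0 : x ≠ 0 := by
    rintro rfl
    refine hx0 (Subtype.ext ?_)
    ext i
    fin_cases i <;> simp [Fintype.card_ne_zero]
  have hd := hdet _ hxH _ hyH
  simp only [Matrix.cons_val_zero, Matrix.cons_val_one, Matrix.cons_val_fin_one, ← hqdef] at hd
  have h4 : ∀ z : K, z ^ q ^ 4 = σ (σ (σ (σ z))) := fun z => by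
    simp only [← hσq, ← pow_mul]
    congr 1
    ring
  simp only [h4, hσq] at hd
  -- `a = 0` means that `y / x` is fixed by Frobenius; otherwise `x, y` produce a root of `f_δ`.
  by_cases ha : x * σ y - y * σ x = 0
  · obtain ⟨c, hc⟩ := exists_algebraMap_eq_of_pow_card (F := F) (x := y / x) (by
      rw [← hqdef, hσq, map_div₀]
      have : σ x ≠ 0 := (map_ne_zero σ).2 hx0
      field_simp
      linear_combination ha)
    obtain rfl : c • x = y := by
      rw [Algebra.smul_def, hc, div_mul_cancel₀ _ hx0]
    refine ⟨c, Subtype.ext ?_⟩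
    have hcq : ∀ z : K, σ (c • z) = c • σ z := map_smul (FiniteField.frobeniusAlgHom F K) c
    ext i
    fin_cases i
    · simp
    · simp only [SetLike.mk_smul_mk, Fin.mk_one, Pi.smul_apply, Matrix.cons_val_one,
        Matrix.cons_val_fin_one, ← hqdef, h4, hσq, hcq, smul_add, mul_smul_comm]
  · exfalso
    rw [trace_eq_zero_iff hK] at hx hy
    simp only [← hqdef, hσq] at hx hy
    have hr := plucker_quadratic σ hσ hx hy rfl rfl
    set a := x * σ y - y * σ x with hadef
    set b := x * σ (σ y) - y * σ (σ x)
    have hα : σ (σ (σ (σ a))) ≠ 0 := by simpa using ha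
    have haα : a = δ * σ (σ (σ (σ a))) := by
      simp only [hadef, map_mul, map_sub, hσ]
      linear_combination hd
    refine hroot ⟨(b + a) / σ (σ (σ (σ a))), (polyF_isRoot_iff hα ?_ _).2 ?_⟩
    · rw [hσq, hσ, ← haα]
    · simp only [hσq, hσ]
      rw [mul_div_cancel₀ _ hα]
      linear_combination hr

theorem not_isScattered_of_isRoot {F K : Type*} [Field F] [Fintype F] [Field K] [Algebra F K]
    (hK : Module.finrank F K = 5) {δ y : K} (hδ : Algebra.norm F δ = 1)
    (hroot : (polyF (Fintype.card F) δ).IsRoot y) : ¬ IsScattered (subspaceU F δ) := by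
  classical
  have : Module.Finite F K := Module.finite_of_finrank_pos (by omega)
  have hσ := frobenius_five hK
  obtain ⟨α, hα, hαδ⟩ := exists_pow_card_eq_mul hδ
  have hq : 1 < Fintype.card F := Fintype.one_lt_card
  rw [polyF_isRoot_iff hα hαδ] at hroot
  set q := Fintype.card F with hqdef
  let σ : K →+* K := (FiniteField.frobeniusAlgHom F K).toRingHom
  have hσq : ∀ z, z ^ q = σ z := fun z => rfl
  simp only [hσq] at hσ hroot hαδ
  obtain ⟨a, ha, rfl⟩ : ∃ a, a ≠ 0 ∧ σ (σ (σ (σ a))) = α :=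
    ⟨σ α, by simpa using hα, hσ α⟩
  simp only [hσ] at hroot hαδ
  set c := σ (σ (σ (σ a))) * y + σ a + σ (σ (σ a)) with hcdef
  have hc : σ c = c := by
    refine map_eq_self_of_quadratic σ hσ
      (s := a + σ a + σ (σ a) + σ (σ (σ a)) + σ (σ (σ (σ a))))
      (p := a * σ a + σ a * σ (σ a) + σ (σ a) * σ (σ (σ a))
        + σ (σ (σ a)) * σ (σ (σ (σ a))) + σ (σ (σ (σ a))) * a) ?_ ?_ ?_
    · simp only [map_add, hσ]
      ring
    · simp only [map_add, map_mul, hσ]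
      ring
    · linear_combination hroot
  set b := c - a - σ a - σ (σ (σ a)) with hbdef
  have hb1 : σ b = c - σ a - σ (σ a) - σ (σ (σ (σ a))) := by simp only [hbdef, map_sub, hc]
  have hb3 : σ (σ (σ b)) = c - σ (σ (σ a)) - σ (σ (σ (σ a))) - σ a := by
    simp only [hbdef, map_sub, hc, hσ]
  have hb4 : σ (σ (σ (σ b))) = c - σ (σ (σ (σ a))) - a - σ (σ a) := by
    simp only [hbdef, map_sub, hc, hσ]
  have hP : a * σ (σ a) = b * σ b + σ (σ (σ b)) * σ a := by
    rw [hb3, hb1]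
    linear_combination -hroot
  obtain ⟨s, hs, hsx⟩ := card_roots_of_plucker hK ha hP
  simp only [← hqdef, hσq] at hs hsx
  have hx4 : ∀ x ∈ s, a * σ (σ (σ (σ x))) = σ (σ (σ (σ b))) * x - σ (σ (σ (σ a))) * σ x :=
    fun x hx => (isUnit_recurrence σ ha.isUnit (hσ a) (hσ b) hP (hsx x hx)).2.1
  have hx3 : ∀ x ∈ s, a * σ (σ (σ x)) = -σ b * x - σ (σ (σ b)) * σ x :=
    fun x hx => (isUnit_recurrence σ ha.isUnit (hσ a) (hσ b) hP (hsx x hx)).1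
  intro hsc
  -- The recurrence for the roots gives `σ x + δ σ⁴ x = (δ σ⁴ b / a) x`: this is the line `K ∙ v`.
  let v : Fin 2 → K := ![1, δ * σ (σ (σ (σ b))) / a]
  have hv : v ≠ 0 := fun h => one_ne_zero (congrFun h 0)
  have hle := hsc (K ∙ v) (finrank_span_singleton hv)
  rw [finrank_le_one_iff] at hle
  obtain ⟨w, hw⟩ := hle
  -- A generator `w` of the intersection over `F` leaves room for only `q` first coordinates.
  have hsub : s ⊆ Finset.univ.image fun c : F => c • (w : Fin 2 → K) 0 := by
    intro x hx
    have hU : ![x, x ^ q + δ * x ^ q ^ 4] ∈ subspaceU F δ := by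
      refine ⟨x, ?_, rfl⟩
      rw [trace_eq_zero_iff hK]
      simp only [← hqdef, hσq]
      refine (mul_eq_zero.1 ?_).resolve_left ha
      linear_combination hsx x hx + hx3 x hx + hx4 x hx + x * (hb4 - hb1) + σ x * (hbdef - hb3)
    have hH : ![x, x ^ q + δ * x ^ q ^ 4] ∈ (K ∙ v).restrictScalars F := by
      rw [Submodule.restrictScalars_mem, Submodule.mem_span_singleton]
      refine ⟨x, ?_⟩
      have h4 : x ^ q ^ 4 = σ (σ (σ (σ x))) := by
        simp only [← hσq, ← pow_mul]
        congr 1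
        ring
      ext i
      fin_cases i
      · simp [v]
      · simp only [v, Fin.mk_one, Pi.smul_apply, Matrix.cons_val_one, Matrix.cons_val_fin_one,
          h4, hσq, smul_eq_mul]
        field_simp
        linear_combination -δ * hx4 x hx - σ x * hαδ
    obtain ⟨c, hc⟩ := hw ⟨_, hU, hH⟩
    have hc0 : c • (w : Fin 2 → K) 0 = x := congrFun (congrArg Subtype.val hc) 0
    exact Finset.mem_image.2 ⟨c, Finset.mem_univ c, hc0⟩
  have hcard := (Finset.card_le_card hsub).trans Finset.card_image_le
  rw [hs, Finset.card_univ, ← hqdef] at hcard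
  nlinarith

theorem polyF_one_not_isRoot {F K : Type*} [Field F] [Fintype F] [Field K] [Algebra F K]
    (hK : Module.finrank F K = 5) {h : ℕ} (hF : Fintype.card F = 3 ^ (2 * h + 1)) (y : K) :
    ¬ (polyF (Fintype.card F) (1 : K)).IsRoot y := by
  have : Module.Finite F K := Module.finite_of_finrank_pos (by omega)
  have : Finite K := Module.finite_of_finite F
  have := Fintype.ofFinite K
  have hcard : Fintype.card K = 3 ^ (2 * (5 * h + 2) + 1) := by
    rw [Module.card_eq_pow_finrank (K := F) (V := K), hK, hF, ← pow_mul]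
    congr 1
    ring
  have h3 : (3 : K) = 0 := by
    have h0 : ((Fintype.card K : ℕ) : K) = 0 := FiniteField.cast_card_eq_zero K
    rw [hcard, Nat.cast_pow] at h0
    exact_mod_cast eq_zero_of_pow_eq_zero h0
  intro hy
  simp only [polyF, IsRoot.def, eval_add, eval_mul, eval_C, eval_pow, eval_X, one_pow] at hy
  -- Completing the square, `(2 y - 1) ^ 2 = 5 = -1`.
  have hsq : IsSquare (-1 : K) := ⟨2 * y - 1, by linear_combination -4 * hy - 2 * h3⟩
  rw [FiniteField.isSquare_neg_one_iff, hcard, pow_succ, pow_mul] at hsq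
  refine hsq ?_
  rw [Nat.mul_mod, Nat.pow_mod]
  norm_num

theorem proposition3p6 {F K : Type*} [Field F] [Fintype F] [Field K] [Algebra F K]
    (hK : Module.finrank F K = 5) (hq : Odd (Fintype.card F)) :
    (∀ δ : K, Algebra.norm F δ = 1 →
      ((IsScattered (subspaceU F δ) ∧ Module.finrank F (subspaceU F δ) = 4) ↔
        ¬ ∃ y : K, (polyF (Fintype.card F) δ).IsRoot y)) ∧
    (∀ h : ℕ, Fintype.card F = 3 ^ (2 * h + 1) →
      IsScattered (subspaceU F (1 : K)) ∧ Module.finrank F (subspaceU F (1 : K)) = 4) := by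
  refine ⟨fun δ hδ => ⟨?_, fun hroot => ⟨isScattered_of_no_root hK hroot,
    finrank_subspaceU hK δ⟩⟩, fun h hF => ⟨isScattered_of_no_root hK ?_, finrank_subspaceU hK 1⟩⟩
  · rintro ⟨hsc, -⟩ ⟨y, hy⟩
    exact not_isScattered_of_isRoot hK hδ hy hsc
  · rintro ⟨y, hy⟩
    exact polyF_one_not_isRoot hK hF y hy
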